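/- Let $K$ be any field with algebraic closure $\overline K$, let $s\ge 3$, and let $\mathcal L=\{L_1,\dots,L_s\}$ be a set of $s$ pairwise skew (i.e. pairwise disjoint) lines in $\mathbb P^3_K$. For distinct indices $i,j,k$ let $f_{ijk}\colon L_i\to L_j$ be the linear isomorphism that sends a point $p\in L_i$ to the point where the plane spanned by $p$ and $L_k$ meets $L_j$. Let $C_{\mathcal L}$ be the groupoid whose objects are the lines $L_i$ and whose arrows are the maps $f_{ijk}$ and all their compositions, and let $G_{\mathcal L}$ be the group $\mathrm{Hom}_{C_{\mathcal L}}(L_i,L_i)$ (which up to isomorphism does not depend on $i$). A transversal for $\mathcal L$ is a line $T\subset\mathbb P^3_{\overline K}$ that meets all of $L_1,\dots,L_s$ (regarded as lines over $\overline K$). A transversal $T$ for $\mathcal L$ has multiplicity $2$ if no smooth quadric contains all the lines $L_i$ and, for some choice of three distinct indices $a,b,c$, every line $L_i$ is either contained in the unique smooth quadric $Q_{abc}$ containing $L_a,L_b,L_c$, or tangent to $Q_{abc}$ at the point $L_i\cap T$ (this does not depend on the choice of $a,b,c$). Then $G_{\mathcal L}$ is abelian if and only if $\mathcal L$ has at least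 two distinct transversals or has a transversal of multiplicity $2$. -/

import Mathlib

open scoped LinearAlgebra.Projectivization

universe u

/-- `s` pairwise skew lines in `ℙ³` over `K`.  A line of `ℙ³` is a two-dimensional linear subspace
of `K⁴`, and two lines are skew when they have no common point, i.e. when the subspaces meet only
in `0` (in particular the lines are distinct). -/
structure SkewLines (K : Type u) [Field K] (s : ℕ) where
  line : Fin s → Submodule K (Fin 4 → K)
  finrank_line : ∀ i, Module.finrank K (line i) = 2
  skew : ∀ i j, i ≠ j → Disjoint (line i) (line j)

namespace SkewLines

variable {K : Type u} [Field K] {s : ℕ}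

theorem isCompl (L : SkewLines K s) {j k : Fin s} (h : j ≠ k) :
    IsCompl (L.line j) (L.line k) := by
  have hd := L.skew j k h
  refine ⟨hd, codisjoint_iff.2 (Submodule.eq_top_of_disjoint _ _ ?_ hd)⟩
  simp [L.finrank_line]

/-- For distinct `i, j, k`, the restriction to `L_i` of the linear projection of `K⁴` onto `L_j`
with kernel `L_k`; it is an isomorphism `L_i ≃ L_j` with inverse the projection the other way. -/
noncomputable def proj (L : SkewLines K s) (i j k : Fin s) (hik : i ≠ k) (hjk : j ≠ k) :
    L.line i ≃ₗ[K] L.line j where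
  toFun x := (L.line j).projectionOnto (L.line k) (L.isCompl hjk) x
  map_add' x y := by simp
  map_smul' c x := by simp
  invFun y := (L.line i).projectionOnto (L.line k) (L.isCompl hik) y
  left_inv x := by
    have h := (L.line j).sub_projection_mem (L.isCompl hjk) (x : Fin 4 → K)
    have h2 := (Submodule.projectionOnto_apply_eq_zero_iff (L.isCompl hik)).2 h
    rw [map_sub, sub_eq_zero] at h2
    rw [Submodule.projectionOnto_apply_left] at h2
    exact h2.symm
  right_inv y := by
    have h := (L.line i).sub_projection_mem (L.isCompl hik) (y : Fin 4 → K)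
    have h2 := (Submodule.projectionOnto_apply_eq_zero_iff (L.isCompl hjk)).2 h
    rw [map_sub, sub_eq_zero] at h2
    rw [Submodule.projectionOnto_apply_left] at h2
    exact h2.symm

/-- The map `f_{ijk} : L_i → L_j` on points: a point `p` of the line `L_i` goes to the point where
the plane spanned by `p` and `L_k` meets `L_j` (see `persp_apply_eq_iff`). -/
noncomputable def persp (L : SkewLines K s) (i j k : Fin s) (hik : i ≠ k) (hjk : j ≠ k) :
    ℙ K (L.line i) ≃ ℙ K (L.line j) where
  toFun := Projectivization.map (L.proj i j k hik hjk).toLinearMap (L.proj i j k hik hjk).injective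
  invFun := Projectivization.map (L.proj i j k hik hjk).symm.toLinearMap
    (L.proj i j k hik hjk).symm.injective
  left_inv p := by
    induction p using Projectivization.ind with
    | h v hv => simp [Projectivization.map_mk]
  right_inv p := by
    induction p using Projectivization.ind with
    | h v hv => simp [Projectivization.map_mk]

/-- `f_{ijk}(p)` is the unique point `q` of `L_j` in the span of `p` and `L_k`. -/
theorem persp_apply_eq_iff (L : SkewLines K s) (i j k : Fin s) (hik : i ≠ k) (hjk : j ≠ k)
    (p : ℙ K (L.line i)) (q : ℙ K (L.line j)) :
    L.persp i j k hik hjk p = q ↔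
      ((q.rep : L.line j) : Fin 4 → K) ∈
        Submodule.span K {((p.rep : L.line i) : Fin 4 → K)} ⊔ L.line k := by
  have hp : L.persp i j k hik hjk p = Projectivization.mk K (L.proj i j k hik hjk p.rep)
      ((L.proj i j k hik hjk).map_ne_zero_iff.2 p.rep_nonzero) := by
    conv_lhs => rw [← p.mk_rep]
    rfl
  have key : ∀ (x : L.line i), ((L.proj i j k hik hjk x : L.line j) : Fin 4 → K) - x ∈ L.line k :=
    fun x => by
      have h := (L.line j).sub_projection_mem (L.isCompl hjk) (x : Fin 4 → K)
      rw [← neg_sub]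
      exact (L.line k).neg_mem h
  rw [hp]
  conv_lhs => rw [← q.mk_rep]
  rw [eq_comm, Projectivization.mk_eq_mk_iff', Submodule.mem_sup]
  constructor
  · rintro ⟨a, ha⟩
    refine ⟨a • (p.rep : Fin 4 → K), Submodule.smul_mem _ _ (Submodule.mem_span_singleton_self _),
      _, (L.line k).smul_mem a (key p.rep), ?_⟩
    rw [← ha]
    simp [smul_sub]
  · rintro ⟨y, hy, z, hz, h⟩
    obtain ⟨a, rfl⟩ := Submodule.mem_span_singleton.1 hy
    refine ⟨a, Subtype.ext (sub_eq_zero.1 ?_)⟩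
    refine Submodule.disjoint_def.1 (L.skew j k hjk) _
      (Submodule.sub_mem _ (Subtype.coe_prop _) (Subtype.coe_prop _)) ?_
    rw [← h]
    have := (L.line k).sub_mem ((L.line k).smul_mem a (key p.rep)) hz
    convert this using 1
    simp only [Submodule.coe_smul, smul_sub]
    abel

/-- The arrows `L_i → L_j`: the maps `f_{ijk}` (with `i, j, k` distinct) and all compositions of
them.  (For `s ≥ 3` the identities are such compositions, `f_{jik} ∘ f_{ijk} = id`.) -/
inductive IsArrow (L : SkewLines K s) :
    ∀ i j : Fin s, (ℙ K (L.line i) ≃ ℙ K (L.line j)) → Prop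
  | id (i : Fin s) : IsArrow L i i (Equiv.refl _)
  | gen (i j k : Fin s) (hij : i ≠ j) (hik : i ≠ k) (hjk : j ≠ k) :
      IsArrow L i j (L.persp i j k hik hjk)
  | comp {i j k : Fin s} {f : ℙ K (L.line i) ≃ ℙ K (L.line j)}
      {g : ℙ K (L.line j) ≃ ℙ K (L.line k)} :
      IsArrow L i j f → IsArrow L j k g → IsArrow L i k (f.trans g)

theorem persp_symm (L : SkewLines K s) (i j k : Fin s) (hik : i ≠ k) (hjk : j ≠ k) :
    (L.persp i j k hik hjk).symm = L.persp j i k hjk hik := rfl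

theorem IsArrow.symm {L : SkewLines K s} {i j : Fin s} {f : ℙ K (L.line i) ≃ ℙ K (L.line j)}
    (h : L.IsArrow i j f) : L.IsArrow j i f.symm := by
  induction h with
  | id i => exact .id i
  | gen i j k hij hik hjk => exact .gen j i k hij.symm hjk hik
  | comp _ _ hf hg => exact .comp hg hf

/-- The objects of the groupoid `C_𝓛`: the lines `L_1, …, L_s`, given by their indices. -/
structure Obj (L : SkewLines K s) where
  idx : Fin s

/-- The groupoid `C_𝓛`. -/
noncomputable instance groupoid (L : SkewLines K s) : CategoryTheory.Groupoid L.Obj where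
  Hom a b := {f : ℙ K (L.line a.idx) ≃ ℙ K (L.line b.idx) // L.IsArrow a.idx b.idx f}
  id a := ⟨Equiv.refl _, .id _⟩
  comp f g := ⟨f.1.trans g.1, f.2.comp g.2⟩
  inv f := ⟨f.1.symm, f.2.symm⟩
  inv_comp f := Subtype.ext (Equiv.symm_trans_self f.1)
  comp_inv f := Subtype.ext (Equiv.self_trans_symm f.1)

/-- The group `G_𝓛` of the groupoid, realized on the line `L_i` as `Hom(L_i, L_i)`. -/
abbrev G (L : SkewLines K s) (i : Fin s) : Type u := CategoryTheory.End (Obj.mk (L := L) i)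

/-- The line `L_i`, considered as a line in `ℙ³` over the algebraic closure of `K`. -/
noncomputable def geomLine (L : SkewLines K s) (i : Fin s) :
    Submodule (AlgebraicClosure K) (Fin 4 → AlgebraicClosure K) :=
  Submodule.span (AlgebraicClosure K)
    ((fun v : Fin 4 → K => fun t => algebraMap K (AlgebraicClosure K) (v t)) '' (L.line i))

/-- A transversal: a line of `ℙ³` over the algebraic closure of `K` that meets every `L_i`. -/
def IsTransversal (L : SkewLines K s)
    (T : Submodule (AlgebraicClosure K) (Fin 4 → AlgebraicClosure K)) : Prop :=
  Module.finrank (AlgebraicClosure K) T = 2 ∧ ∀ i, T ⊓ L.geomLine i ≠ ⊥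

end SkewLines

/-- The quadric `Q = 0` in `ℙ³` is smooth: the gradient of `Q`, which at `v` is the linear form
`w ↦ Q (v + w) - Q v - Q w`, does not vanish at any point of the quadric. -/
def IsSmoothQuadric {F : Type u} [Field F] (Q : QuadraticForm F (Fin 4 → F)) : Prop :=
  ∀ v, v ≠ 0 → Q v = 0 → ∃ w, QuadraticMap.polar Q v w ≠ 0

/-- The linear subspace `W` is contained in the quadric `Q = 0`.  (Used over an algebraically
closed field, where containment may be tested on points.) -/
def QuadricContains {F : Type u} [Field F] (Q : QuadraticForm F (Fin 4 → F))
    (W : Submodule F (Fin 4 → F)) : Prop :=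
  ∀ w ∈ W, Q w = 0

/-- The line `W` is tangent to the quadric `Q = 0` at the point `p`: the point `p` lies on `W` and
on the quadric, and `W` is contained in the tangent plane of the quadric at `p`. -/
def IsTangentAt {F : Type u} [Field F] (Q : QuadraticForm F (Fin 4 → F))
    (W : Submodule F (Fin 4 → F)) (p : Fin 4 → F) : Prop :=
  p ∈ W ∧ Q p = 0 ∧ ∀ w ∈ W, QuadraticMap.polar Q p w = 0

namespace SkewLines

variable {K : Type u} [Field K] {s : ℕ}

/-- `T` is a transversal of multiplicity 2 with respect to the three distinct indices `a, b, c`: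
`T` is a transversal, no smooth quadric contains all the lines, and every line is contained in the
smooth quadric `Q` through `L_a, L_b, L_c` (which is unique) or tangent to it at its point on `T`.
-/
def IsMultTwoWrt (L : SkewLines K s)
    (T : Submodule (AlgebraicClosure K) (Fin 4 → AlgebraicClosure K)) (a b c : Fin s) : Prop :=
  L.IsTransversal T ∧
  (¬ ∃ Q : QuadraticForm (AlgebraicClosure K) (Fin 4 → AlgebraicClosure K),
      IsSmoothQuadric Q ∧ ∀ i, QuadricContains Q (L.geomLine i)) ∧
  ∃ Q : QuadraticForm (AlgebraicClosure K) (Fin 4 → AlgebraicClosure K),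
    IsSmoothQuadric Q ∧
    QuadricContains Q (L.geomLine a) ∧ QuadricContains Q (L.geomLine b) ∧
    QuadricContains Q (L.geomLine c) ∧
    ∀ i, QuadricContains Q (L.geomLine i) ∨
      ∀ p ∈ L.geomLine i ⊓ T, p ≠ 0 → IsTangentAt Q (L.geomLine i) p

/-- `T` is a transversal of multiplicity 2: it is so with respect to some choice of three distinct
indices (the choice is immaterial). -/
def IsMultTwoTransversal (L : SkewLines K s)
    (T : Submodule (AlgebraicClosure K) (Fin 4 → AlgebraicClosure K)) : Prop :=
  ∃ a b c : Fin s, a ≠ b ∧ a ≠ c ∧ b ≠ c ∧ L.IsMultTwoWrt T a b c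

end SkewLines

/-! Choosing three of the lines splits `K⁴` as `K² ⊕ K²`, so that they become `{(x, 0)}`, `{(0, x)}`
and `{(x, x)}`, and every further line is a graph `{(x, V_j x)}`. Both sides of the equivalence then
say that the matrices `V_j` commute.

Group side: every arrow has a matrix commuting with the whole centralizer of the `V_j`, so commuting
`V_j` make the group abelian (`G_comm_of_V_comm`). Conversely, `V_j` and `1 - V_j⁻¹` are matrices of
loops at the first line. An abelian group only makes such matrices commute up to scalars, but
together the two relations force true commutation (`V_comm_of_G_comm`,
`Matrix.commute_of_projectively_commute`).

Geometric side, over the algebraic closure: transversals are the lines spanned by `(v, 0)` and `(0,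
v)` with `v` a common eigenvector of the `V_j`. The quadrics through the three chosen lines are `t *
wedge x y = 0`, and tangency along the transversal of `v` says that `V_j` minus its eigenvalue at
`v` maps into the line of `v`. By `Matrix.exists_common_eigenvectors`, a commuting family has two
independent common eigenvectors or is of this tangent type without being scalar; either condition
gives back commutation. -/

/-! ### Commuting families of two-by-two matrices. -/

section TwoByTwo

open Matrix

variable {F : Type u} [Field F]

/-- The determinant of a pair of vectors of the plane. -/
def wedge (x y : Fin 2 → F) : F := x 0 * y 1 - x 1 * y 0

theorem wedge_self (x : Fin 2 → F) : wedge x x = 0 := by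
  simp [wedge, mul_comm]

theorem wedge_smul_self (c : F) (x : Fin 2 → F) : wedge x (c • x) = 0 := by
  simp only [wedge, Pi.smul_apply, smul_eq_mul]; ring

theorem exists_eq_smul_of_wedge_eq_zero {x y : Fin 2 → F} (hx : x ≠ 0) (h : wedge x y = 0) :
    ∃ c : F, y = c • x := by
  simp only [wedge] at h
  by_cases h0 : x 0 = 0
  · have h1 : x 1 ≠ 0 := fun h1 => hx (by ext i; fin_cases i <;> simp [h0, h1])
    refine ⟨y 1 / x 1, ?_⟩
    ext i
    fin_cases i
    · have : x 1 * y 0 = 0 := by rw [h0] at h; linear_combination -h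
      simp [h0, (mul_eq_zero.1 this).resolve_left h1]
    · simp [h1]
  · refine ⟨y 0 / x 0, ?_⟩
    ext i
    fin_cases i
    · simp [h0]
    · simp only [Fin.mk_one, Pi.smul_apply, smul_eq_mul]
      field_simp
      linear_combination h

theorem exists_combination_of_wedge_ne_zero {x y : Fin 2 → F} (h : wedge x y ≠ 0)
    (z : Fin 2 → F) : ∃ a b : F, z = a • x + b • y := by
  refine ⟨wedge z y / wedge x y, wedge x z / wedge x y, ?_⟩
  ext i
  fin_cases i
  · simp only [Fin.zero_eta, Pi.add_apply, Pi.smul_apply, smul_eq_mul]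
    field_simp
    simp only [wedge]; ring
  · simp only [Fin.mk_one, Pi.add_apply, Pi.smul_apply, smul_eq_mul]
    field_simp
    simp only [wedge]; ring

theorem Matrix.eq_of_mulVec_eq_of_wedge_ne_zero {A B : Matrix (Fin 2) (Fin 2) F}
    {x y : Fin 2 → F} (h : wedge x y ≠ 0) (hx : A *ᵥ x = B *ᵥ x) (hy : A *ᵥ y = B *ᵥ y) :
    A = B := by
  refine Matrix.ext_of_mulVec_single fun i => ?_
  obtain ⟨a, b, hab⟩ := exists_combination_of_wedge_ne_zero h (Pi.single i 1)
  rw [hab, mulVec_add, mulVec_add, mulVec_smul, mulVec_smul, mulVec_smul, mulVec_smul, hx, hy]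

theorem Matrix.commute_of_common_eigenvectors {A B : Matrix (Fin 2) (Fin 2) F}
    {x y : Fin 2 → F} (h : wedge x y ≠ 0) {a a' b b' : F} (hax : A *ᵥ x = a • x)
    (hay : A *ᵥ y = a' • y) (hbx : B *ᵥ x = b • x) (hby : B *ᵥ y = b' • y) :
    A * B = B * A := by
  refine Matrix.eq_of_mulVec_eq_of_wedge_ne_zero h ?_ ?_
  · simp only [← mulVec_mulVec, hax, hbx, mulVec_smul, smul_comm a]
  · simp only [← mulVec_mulVec, hay, hby, mulVec_smul, smul_comm a']

/-- Both `A - a` and `B - b` kill `x` and have image in the line of `x`, so their products in either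
order vanish. -/
theorem Matrix.commute_of_common_tangent {A B : Matrix (Fin 2) (Fin 2) F}
    {x : Fin 2 → F} (hx : x ≠ 0) {a b : F} (hax : A *ᵥ x = a • x) (hbx : B *ᵥ x = b • x)
    (ha : ∀ w, wedge x (A *ᵥ w - a • w) = 0) (hb : ∀ w, wedge x (B *ᵥ w - b • w) = 0) :
    A * B = B * A := by
  refine Matrix.ext_of_mulVec_single fun i => ?_
  obtain ⟨c, hc⟩ := exists_eq_smul_of_wedge_eq_zero hx (ha (Pi.single i 1))
  obtain ⟨d, hd⟩ := exists_eq_smul_of_wedge_eq_zero hx (hb (Pi.single i 1))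
  rw [sub_eq_iff_eq_add] at hc hd
  simp only [← mulVec_mulVec, hc, hd, mulVec_add, mulVec_smul, hax, hbx]
  module

/-- The vector `u` is cyclic for `A`: once `X u` is written in the basis `u`, `A u`, commutation
determines `X` on `A u` too. -/
theorem Matrix.exists_smul_one_add_smul_of_commute {A X : Matrix (Fin 2) (Fin 2) F}
    {u : Fin 2 → F} (hu : wedge u (A *ᵥ u) ≠ 0) (h : X * A = A * X) :
    ∃ a b : F, X = a • 1 + b • A := by
  obtain ⟨a, b, hab⟩ := exists_combination_of_wedge_ne_zero hu (X *ᵥ u)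
  refine ⟨a, b, Matrix.eq_of_mulVec_eq_of_wedge_ne_zero hu ?_ ?_⟩
  · simp [add_mulVec, smul_mulVec, hab]
  · rw [mulVec_mulVec, h, ← mulVec_mulVec, hab]
    simp only [add_mulVec, smul_mulVec, one_mulVec, mulVec_add, mulVec_smul]

/-- A commuting family of two-by-two matrices over an algebraically closed field has two
independent common eigenvectors, or it is not scalar and acts by scalars on a line and on the
quotient by it, with equal scalars. -/
theorem Matrix.exists_common_eigenvectors [IsAlgClosed F] {ι : Type*}
    (V : ι → Matrix (Fin 2) (Fin 2) F) (h : ∀ i j, V i * V j = V j * V i) :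
    (∃ v w, wedge v w ≠ 0 ∧
      ∀ j, (∃ a : F, V j *ᵥ v = a • v) ∧ ∃ a : F, V j *ᵥ w = a • w) ∨
    ∃ v, v ≠ 0 ∧
      (∀ j, ∃ a : F, V j *ᵥ v = a • v ∧ ∀ w, wedge v (V j *ᵥ w - a • w) = 0) ∧
      ∃ j w, wedge w (V j *ᵥ w) ≠ 0 := by
  -- This is the scalar case: every vector is an eigenvector of every `V j`.
  by_cases hs : ∀ j w, wedge w (V j *ᵥ w) = 0
  · left
    refine ⟨![1, 0], ![0, 1], by simp [wedge], fun j => ⟨?_, ?_⟩⟩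
    · exact exists_eq_smul_of_wedge_eq_zero (fun h => by simpa using congrFun h 0) (hs j _)
    · exact exists_eq_smul_of_wedge_eq_zero (fun h => by simpa using congrFun h 1) (hs j _)
  push Not at hs
  obtain ⟨k, u, hu⟩ := hs
  set A := V k with hA
  have hpoly : ∀ j, ∃ a b : F, V j = a • 1 + b • A := fun j =>
    Matrix.exists_smul_one_add_smul_of_commute hu (h j k)
  obtain ⟨l, hl⟩ := Module.End.exists_eigenvalue (Matrix.toLin' A)
  obtain ⟨v, hv⟩ := hl.exists_hasEigenvector
  have hv0 : v ≠ 0 := hv.2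
  have hAv : A *ᵥ v = l • v := by simpa using hv.apply_eq_smul
  have hdet : (A - l • 1).det = 0 := by
    refine Matrix.exists_mulVec_eq_zero_iff.1 ⟨v, hv0, ?_⟩
    simp [sub_mulVec, smul_mulVec, hAv]
  have heig : ∀ (m : F) (x : Fin 2 → F), A *ᵥ x = m • x → ∀ j, ∃ a : F, V j *ᵥ x = a • x := by
    intro m x hx j
    obtain ⟨a, b, hab⟩ := hpoly j
    refine ⟨a + b * m, ?_⟩
    rw [hab, add_mulVec, smul_mulVec, smul_mulVec, hx, one_mulVec]
    module
  -- Trace minus `l` is the other eigenvalue of `A`; the split is between a double eigenvalue and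
  -- two distinct ones.
  by_cases hm : A 0 0 + A 1 1 - l = l
  · right
    refine ⟨v, hv0, fun j => ?_, k, u, hu⟩
    obtain ⟨a, b, hab⟩ := hpoly j
    refine ⟨a + b * l, ?_, fun w => ?_⟩
    · rw [hab, add_mulVec, smul_mulVec, smul_mulVec, hAv, one_mulVec]
      module
    -- Cayley–Hamilton: the characteristic polynomial is `(X - l)²`.
    have hN2 : (A - l • 1) * (A - l • 1) = 0 := by
      simp only [det_fin_two, sub_apply, smul_apply, smul_eq_mul, one_apply_eq,
        one_apply, Fin.isValue, zero_ne_one, one_ne_zero, if_false] at hdet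
      ext i j
      fin_cases i <;> fin_cases j <;>
        simp [Matrix.mul_apply, Fin.sum_univ_two, one_apply]
      · linear_combination -hdet + (A 0 0 - l) * hm
      · linear_combination (A 0 1) * hm
      · linear_combination (A 1 0) * hm
      · linear_combination -hdet + (A 1 1 - l) * hm
    have hNw : wedge v ((A - l • 1) *ᵥ w) = 0 := by
      -- Otherwise `A - l` kills the basis formed by `v` and `(A - l) w`, hence is zero.
      by_contra hne
      have : A - l • 1 = 0 := by
        refine Matrix.eq_of_mulVec_eq_of_wedge_ne_zero hne ?_ ?_
        · simp [sub_mulVec, smul_mulVec, hAv]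
        · rw [mulVec_mulVec, hN2, zero_mulVec, zero_mulVec]
      rw [this] at hne
      simp [wedge] at hne
    obtain ⟨c, hc⟩ := exists_eq_smul_of_wedge_eq_zero hv0 hNw
    have : V j *ᵥ w - (a + b * l) • w = b • ((A - l • 1) *ᵥ w) := by
      rw [hab, add_mulVec, sub_mulVec, smul_mulVec, smul_mulVec, smul_mulVec, one_mulVec]
      module
    rw [this, hc, smul_smul, wedge_smul_self]
  · left
    set m := A 0 0 + A 1 1 - l with hmdef
    have hdet' : (A - m • 1).det = 0 := by
      simp only [det_fin_two, sub_apply, smul_apply, smul_eq_mul, one_apply_eq,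
        one_apply, Fin.isValue, zero_ne_one, one_ne_zero, if_false] at hdet ⊢
      rw [hmdef]
      linear_combination hdet
    obtain ⟨w, hw0, hw⟩ := Matrix.exists_mulVec_eq_zero_iff.2 hdet'
    have hAw : A *ᵥ w = m • w := by
      rwa [sub_mulVec, smul_mulVec, one_mulVec, sub_eq_zero] at hw
    refine ⟨v, w, fun h0 => ?_, fun j => ⟨heig l v hAv j, heig m w hAw j⟩⟩
    obtain ⟨c, hc⟩ := exists_eq_smul_of_wedge_eq_zero hv0 h0
    have h1 : (m - l) • w = 0 := by
      rw [sub_smul, ← hAw, hc, mulVec_smul, hAv, smul_comm, sub_self]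
    exact hw0 ((smul_eq_zero.1 h1).resolve_left (sub_ne_zero.2 hm))

end TwoByTwo

/-! ### Coordinates adapted to three of the lines. -/

/-- Coordinates on a family of lines in `ℙ³`, adapted to three of them: `F⁴` is the direct sum of
two copies of `F²`, embedded by `P` and `R`; the lines with indices `a`, `b` and `c` are the
ranges of `P`, `R` and `P + R`, and the other lines are the graphs of linear maps `F² → F²`. -/
structure LineCoordinates {F : Type u} [Field F] {s : ℕ}
    (W : Fin s → Submodule F (Fin 4 → F)) (a b c : Fin s) where
  P : Matrix (Fin 4) (Fin 2) F
  R : Matrix (Fin 4) (Fin 2) F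
  P' : Matrix (Fin 2) (Fin 4) F
  R' : Matrix (Fin 2) (Fin 4) F
  U : Fin s → Matrix (Fin 2) (Fin 2) F
  V : Fin s → Matrix (Fin 2) (Fin 2) F
  PP : P' * P = 1
  PR : P' * R = 0
  RP : R' * P = 0
  RR : R' * R = 1
  add_eq : P * P' + R * R' = 1
  U_b : U b = 0
  U_of_ne : ∀ j, j ≠ b → U j = 1
  V_a : V a = 0
  V_b : V b = 1
  V_c : V c = 1
  eq_range : ∀ j, W j = LinearMap.range (P * U j + R * V j).mulVecLin

namespace LineCoordinates

open Matrix

variable {F : Type u} [Field F] {s : ℕ} {W : Fin s → Submodule F (Fin 4 → F)} {a b c : Fin s}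
  (C : LineCoordinates W a b c)

include C

theorem injective {x x' y y' : Fin 2 → F} (h : C.P *ᵥ x + C.R *ᵥ y = C.P *ᵥ x' + C.R *ᵥ y') :
    x = x' ∧ y = y' := by
  constructor
  · simpa [mulVec_add, C.PP, C.PR] using congrArg (C.P' *ᵥ ·) h
  · simpa [mulVec_add, C.RP, C.RR] using congrArg (C.R' *ᵥ ·) h

theorem eq_add (v : Fin 4 → F) : v = C.P *ᵥ (C.P' *ᵥ v) + C.R *ᵥ (C.R' *ᵥ v) := by
  rw [mulVec_mulVec, mulVec_mulVec, ← add_mulVec, C.add_eq, one_mulVec]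

theorem mem_iff (j : Fin s) (v : Fin 4 → F) :
    v ∈ W j ↔ ∃ x, C.P *ᵥ (C.U j *ᵥ x) + C.R *ᵥ (C.V j *ᵥ x) = v := by
  simp [C.eq_range j]

theorem mem_a_iff (hab : a ≠ b) (v : Fin 4 → F) : v ∈ W a ↔ ∃ x, C.P *ᵥ x = v := by
  simp [C.mem_iff, C.U_of_ne a hab, C.V_a]

theorem mem_b_iff (v : Fin 4 → F) : v ∈ W b ↔ ∃ x, C.R *ᵥ x = v := by
  simp [C.mem_iff, C.U_b, C.V_b]

theorem mem_c_iff (hcb : c ≠ b) (v : Fin 4 → F) :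
    v ∈ W c ↔ ∃ x, C.P *ᵥ x + C.R *ᵥ x = v := by
  simp [C.mem_iff, C.U_of_ne c hcb, C.V_c]

theorem mem_iff_of_ne {j : Fin s} (hjb : j ≠ b) (v : Fin 4 → F) :
    v ∈ W j ↔ ∃ x, C.P *ᵥ x + C.R *ᵥ (C.V j *ᵥ x) = v := by
  simp [C.mem_iff, C.U_of_ne j hjb]

theorem eq_zero_of_UV {j : Fin s} {x : Fin 2 → F} (hU : C.U j *ᵥ x = 0) (hV : C.V j *ᵥ x = 0) :
    x = 0 := by
  by_cases hj : j = b
  · subst hj; simpa [C.V_b] using hV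
  · simpa [C.U_of_ne j hj] using hU

/-- The parametrization of the line of index `j` by the plane. -/
noncomputable def param (j : Fin s) : (Fin 2 → F) ≃ₗ[F] W j :=
  (LinearEquiv.ofInjective (C.P * C.U j + C.R * C.V j).mulVecLin (by
    rw [← LinearMap.ker_eq_bot, LinearMap.ker_eq_bot']
    intro x hx
    have h : C.P *ᵥ (C.U j *ᵥ x) + C.R *ᵥ (C.V j *ᵥ x) = C.P *ᵥ 0 + C.R *ᵥ 0 := by
      simpa [add_mulVec] using hx
    exact C.eq_zero_of_UV (C.injective h).1 (C.injective h).2)).trans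
    (LinearEquiv.ofEq _ _ (C.eq_range j).symm)

theorem coe_param (j : Fin s) (x : Fin 2 → F) :
    (C.param j x : Fin 4 → F) = C.P *ᵥ (C.U j *ᵥ x) + C.R *ᵥ (C.V j *ᵥ x) := by
  simp [param]

end LineCoordinates

/-- Here `X = 1 - M⁻¹`. Expanding both relations and cancelling `A` gives `(1 - d) M = 1 - d c`:
either `d = 1`, which forces `c = 1`, or `M` is scalar. -/
theorem Matrix.commute_of_projectively_commute {F : Type u} [Field F]
    {A A' M X : Matrix (Fin 2) (Fin 2) F} {c d : F} (hA : A' * A = 1) (hM : A * M = c • (M * A))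
    (hX : M * X = M - 1) (hAX : A * X = d • (X * A)) : A * M = M * A := by
  set B := 1 - X with hB
  have hMB : M * B = 1 := by rw [hB, mul_sub, mul_one, hX, sub_sub_cancel]
  have hBM : B * M = 1 := mul_eq_one_comm.1 hMB
  have hXB : X = 1 - B := by rw [hB, sub_sub_cancel]
  have hBA : B * A = c • (A * B) := by
    calc B * A = B * (A * M) * B := by rw [mul_assoc, mul_assoc, hMB, mul_one]
      _ = c • ((B * M) * (A * B)) := by
        rw [hM, mul_smul_comm, smul_mul_assoc]; simp only [mul_assoc]
      _ = c • (A * B) := by rw [hBM, one_mul]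
  have h1 : A * ((1 - d) • 1 - (1 - d * c) • B) = 0 := by
    rw [hXB, mul_sub, sub_mul, hBA, mul_one, one_mul, smul_sub, smul_smul] at hAX
    rw [mul_sub, mul_smul_comm, mul_smul_comm, mul_one, sub_smul, sub_smul, one_smul, one_smul]
    rw [← sub_eq_zero] at hAX
    rw [← hAX]
    abel
  have h2 : (1 - d) • 1 - (1 - d * c) • B = 0 := by
    simpa [← mul_assoc, hA] using congrArg (A' * ·) h1
  have h3 : (1 - d) • M = (1 - d * c) • (1 : Matrix (Fin 2) (Fin 2) F) := by
    rw [sub_eq_zero] at h2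
    rw [← hBM, ← smul_mul_assoc, ← h2, smul_mul_assoc, one_mul]
  by_cases hd : d = 1
  · rw [hd, sub_self, zero_smul, one_mul, eq_comm, smul_eq_zero] at h3
    have hc : c = 1 := by
      rcases h3 with h3 | h3
      · exact (sub_eq_zero.1 h3).symm
      · exact absurd h3 one_ne_zero
    rw [hM, hc, one_smul]
  · have hMs : M = ((1 - d)⁻¹ * (1 - d * c)) • (1 : Matrix (Fin 2) (Fin 2) F) := by
      rw [mul_smul, ← h3, smul_smul, inv_mul_cancel₀ (sub_ne_zero.2 (Ne.symm hd)), one_smul]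
    rw [hMs, mul_smul_comm, smul_mul_assoc, mul_one, one_mul]

/-! ### Projective bijections induced by linear equivalences. -/

section Induces

variable {K : Type u} [Field K] {V₁ V₂ V₃ : Type u} [AddCommGroup V₁] [Module K V₁]
  [AddCommGroup V₂] [Module K V₂] [AddCommGroup V₃] [Module K V₃]

/-- The bijection `f` of projective spaces is the one given by the linear equivalence `e`. -/
def InducedBy (f : ℙ K V₁ ≃ ℙ K V₂) (e : V₁ ≃ₗ[K] V₂) : Prop :=
  ∀ p, f p = Projectivization.map e.toLinearMap e.injective p

theorem InducedBy.apply_mk {f : ℙ K V₁ ≃ ℙ K V₂} {e : V₁ ≃ₗ[K] V₂} (h : InducedBy f e)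
    (v : V₁) (hv : v ≠ 0) :
    f (Projectivization.mk K v hv) = Projectivization.mk K (e v) (e.map_ne_zero_iff.2 hv) := by
  rw [h, Projectivization.map_mk]
  rfl

theorem InducedBy.refl : InducedBy (Equiv.refl (ℙ K V₁)) (LinearEquiv.refl K V₁) := by
  intro p
  induction p using Projectivization.ind with
  | h v hv => simp [Projectivization.map_mk]

theorem InducedBy.trans {f : ℙ K V₁ ≃ ℙ K V₂} {g : ℙ K V₂ ≃ ℙ K V₃} {e : V₁ ≃ₗ[K] V₂}
    {e' : V₂ ≃ₗ[K] V₃} (hf : InducedBy f e) (hg : InducedBy g e') :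
    InducedBy (f.trans g) (e.trans e') := by
  intro p
  induction p using Projectivization.ind with
  | h v hv =>
    rw [Equiv.trans_apply, hf.apply_mk, hg.apply_mk, Projectivization.map_mk]
    rfl

/-- Every vector is an eigenvector of `e'⁻¹ e`, which is therefore a homothety. -/
theorem InducedBy.exists_smul {f : ℙ K V₁ ≃ ℙ K V₂} {e e' : V₁ ≃ₗ[K] V₂} (h : InducedBy f e)
    (h' : InducedBy f e') : ∃ c : K, ∀ v, e v = c • e' v := by
  obtain ⟨c, hc⟩ := LinearMap.exists_eq_smul_id_of_forall_notLinearIndependent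
    (f := (e.trans e'.symm).toLinearMap) (fun v => by
      by_cases hv : v = 0
      · exact fun hl => hl.ne_zero 0 (by simp [hv])
      have h1 := (h.apply_mk v hv).symm.trans (h'.apply_mk v hv)
      obtain ⟨d, hd⟩ := (Projectivization.mk_eq_mk_iff' K _ _ _ _).1 h1
      rw [LinearIndependent.pair_iff]
      intro hl
      have h2 := (hl d (-1) (by simp [← hd])).2
      simp at h2)
  refine ⟨c, fun v => ?_⟩
  have h1 := LinearMap.congr_fun hc v
  have h2 := congrArg e' h1
  simpa using h2

end Induces

/-! ### Arrows of the groupoid and change of base line. -/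

namespace SkewLines

variable {K : Type u} [Field K] {s : ℕ} (L : SkewLines K s)

theorem persp_inducedBy (i j k : Fin s) (hik : i ≠ k) (hjk : j ≠ k) :
    InducedBy (L.persp i j k hik hjk) (L.proj i j k hik hjk) :=
  fun _ => rfl

theorem proj_sub_mem (i j k : Fin s) (hik : i ≠ k) (hjk : j ≠ k) (x : L.line i) :
    (L.proj i j k hik hjk x : Fin 4 → K) - x ∈ L.line k := by
  rw [← neg_sub]
  exact (L.line k).neg_mem ((L.line j).sub_projection_mem (L.isCompl hjk) (x : Fin 4 → K))

theorem exists_isArrow (hs : 3 ≤ s) (i j : Fin s) : ∃ f, L.IsArrow i j f := by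
  by_cases hij : i = j
  · subst hij; exact ⟨_, .id i⟩
  · obtain ⟨k, hk⟩ : ∃ k, k ∉ ({i, j} : Finset (Fin s)) := by
      by_contra! h
      have h1 := Finset.card_le_card (fun k _ => h k : Finset.univ ⊆ ({i, j} : Finset (Fin s)))
      have h2 := Finset.card_le_two (a := i) (b := j)
      rw [Finset.card_univ, Fintype.card_fin] at h1
      omega
    simp only [Finset.mem_insert, Finset.mem_singleton, not_or] at hk
    exact ⟨_, .gen i j k hij (Ne.symm hk.1) (Ne.symm hk.2)⟩

theorem trans_comm_of_G_comm (hs : 3 ≤ s) {i : Fin s} (h : ∀ g h : L.G i, g * h = h * g)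
    {a : Fin s} {f g : ℙ K (L.line a) ≃ ℙ K (L.line a)} (hf : L.IsArrow a a f)
    (hg : L.IsArrow a a g) : f.trans g = g.trans f := by
  obtain ⟨t, ht⟩ := L.exists_isArrow hs i a
  have key := h ⟨_, (ht.comp hg).comp ht.symm⟩ ⟨_, (ht.comp hf).comp ht.symm⟩
  have key' : ((t.trans f).trans t.symm).trans ((t.trans g).trans t.symm) =
      ((t.trans g).trans t.symm).trans ((t.trans f).trans t.symm) :=
    congrArg Subtype.val key
  ext p
  have h1 := congrArg t (Equiv.congr_fun key' (t.symm p))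
  simpa using h1

end SkewLines

/-! ### Matrices of arrows: the group is abelian exactly when the `V j` commute. -/

namespace LineCoordinates

open Matrix

variable {F : Type u} [Field F] {s : ℕ} {W : Fin s → Submodule F (Fin 4 → F)} {a b c : Fin s}
  (C : LineCoordinates W a b c)

/-- The matrix, in the parametrizations of two of the lines, of a linear equivalence. -/
noncomputable def matrixOf {i j : Fin s} (e : W i ≃ₗ[F] W j) : Matrix (Fin 2) (Fin 2) F :=
  LinearMap.toMatrix' ((C.param i).trans (e.trans (C.param j).symm)).toLinearMap

theorem matrixOf_mulVec {i j : Fin s} (e : W i ≃ₗ[F] W j) (x : Fin 2 → F) :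
    C.matrixOf e *ᵥ x = (C.param j).symm (e (C.param i x)) := by
  simp [matrixOf, LinearMap.toMatrix'_mulVec]

theorem apply_param {i j : Fin s} (e : W i ≃ₗ[F] W j) (x : Fin 2 → F) :
    e (C.param i x) = C.param j (C.matrixOf e *ᵥ x) := by
  rw [matrixOf_mulVec, LinearEquiv.apply_symm_apply]

theorem matrixOf_refl (i : Fin s) : C.matrixOf (LinearEquiv.refl F (W i)) = 1 := by
  refine Matrix.ext_of_mulVec_single fun m => ?_
  rw [matrixOf_mulVec, LinearEquiv.refl_apply, LinearEquiv.symm_apply_apply, one_mulVec]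

theorem matrixOf_trans {i j k : Fin s} (e : W i ≃ₗ[F] W j) (e' : W j ≃ₗ[F] W k) :
    C.matrixOf (e.trans e') = C.matrixOf e' * C.matrixOf e := by
  refine Matrix.ext_of_mulVec_single fun m => ?_
  rw [← mulVec_mulVec]
  simp only [matrixOf_mulVec, LinearEquiv.trans_apply, LinearEquiv.apply_symm_apply]

theorem matrixOf_injective {i j : Fin s} {e e' : W i ≃ₗ[F] W j}
    (h : C.matrixOf e = C.matrixOf e') : e = e' := by
  ext1 v
  obtain ⟨x, rfl⟩ := (C.param i).surjective v
  rw [C.apply_param, C.apply_param, h]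

theorem matrixOf_eq_smul {i j : Fin s} {e e' : W i ≃ₗ[F] W j} {t : F} (h : ∀ v, e v = t • e' v) :
    C.matrixOf e = t • C.matrixOf e' := by
  refine Matrix.ext_of_mulVec_single fun m => ?_
  rw [smul_mulVec, matrixOf_mulVec, matrixOf_mulVec, h, map_smul]

theorem U_mul_comm (k : Fin s) (X : Matrix (Fin 2) (Fin 2) F) : C.U k * X = X * C.U k := by
  by_cases hk : k = b
  · subst hk; simp [C.U_b]
  · simp [C.U_of_ne k hk]

/-- The matrix whose kernel is trivial because the lines of indices `k` and `j` are skew. -/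
def minor (k j : Fin s) : Matrix (Fin 2) (Fin 2) F := C.V k * C.U j - C.U k * C.V j

variable {K : Type u} [Field K] {L : SkewLines K s} (D : LineCoordinates L.line a b c)

/-- A point of `L_i` and its image in `L_j` differ by a point of `L_k` with some parameter `w`.
Applying `V k` to the first component of this relation and `U k` to the second, then subtracting,
eliminates `w`. -/
theorem minor_mul_matrixOf_proj (i j k : Fin s) (hik : i ≠ k) (hjk : j ≠ k) :
    D.minor k j * D.matrixOf (L.proj i j k hik hjk) = D.minor k i := by
  refine Matrix.ext_of_mulVec_single fun m => ?_
  set x : Fin 2 → K := Pi.single m 1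
  have h := L.proj_sub_mem i j k hik hjk (D.param i x)
  rw [D.apply_param, D.mem_iff] at h
  obtain ⟨w, hw⟩ := h
  rw [eq_sub_iff_add_eq] at hw
  simp only [D.coe_param] at hw
  set X := D.matrixOf (L.proj i j k hik hjk)
  have h' : D.P *ᵥ (D.U k *ᵥ w + D.U i *ᵥ x) + D.R *ᵥ (D.V k *ᵥ w + D.V i *ᵥ x) =
      D.P *ᵥ (D.U j *ᵥ (X *ᵥ x)) + D.R *ᵥ (D.V j *ᵥ (X *ᵥ x)) := by
    rw [← hw]
    simp only [mulVec_add]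
    abel
  obtain ⟨h1, h2⟩ := D.injective h'
  rw [← mulVec_mulVec, minor, minor, sub_mulVec, sub_mulVec]
  simp only [← mulVec_mulVec]
  rw [← h1, ← h2, mulVec_add, mulVec_add, mulVec_mulVec w, mulVec_mulVec w, D.U_mul_comm k (D.V k)]
  abel

theorem eq_zero_of_minor_mulVec_eq_zero {k j : Fin s} (hkj : k ≠ j) {z : Fin 2 → K}
    (h : D.minor k j *ᵥ z = 0) : z = 0 := by
  by_cases hk : k = b
  · subst hk
    simpa [minor, D.U_b, D.V_b, D.U_of_ne j (Ne.symm hkj)] using h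
  · have h1 : D.V k *ᵥ (D.U j *ᵥ z) = D.V j *ᵥ z := by
      rwa [minor, D.U_of_ne k hk, one_mul, sub_mulVec, sub_eq_zero, ← mulVec_mulVec] at h
    have h2 : (D.param j z : Fin 4 → K) ∈ L.line k := by
      rw [D.mem_iff_of_ne hk, D.coe_param]
      exact ⟨_, by rw [h1]⟩
    have h3 := Submodule.disjoint_def.1 (L.skew k j hkj) _ h2 (Subtype.coe_prop _)
    simpa using h3

theorem eq_of_minor_mul_eq {k j : Fin s} (hkj : k ≠ j) {X Y : Matrix (Fin 2) (Fin 2) K}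
    (h : D.minor k j * X = D.minor k j * Y) : X = Y := by
  refine Matrix.ext_of_mulVec_single fun m => sub_eq_zero.1 ?_
  apply D.eq_zero_of_minor_mulVec_eq_zero hkj
  rw [mulVec_sub, mulVec_mulVec, mulVec_mulVec, h, sub_self]

/-- For a generator, the matrix is a quotient of two minors, each built from the `U` and `V`.
Working with the centralizer avoids writing arrows as explicit expressions in the `V m`. -/
theorem exists_linearEquiv_of_isArrow {i j : Fin s} {f : ℙ K (L.line i) ≃ ℙ K (L.line j)}
    (hf : L.IsArrow i j f) : ∃ e : L.line i ≃ₗ[K] L.line j, InducedBy f e ∧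
      ∀ Y, (∀ m, D.V m * Y = Y * D.V m) → D.matrixOf e * Y = Y * D.matrixOf e := by
  induction hf with
  | id i => exact ⟨_, InducedBy.refl, fun Y _ => by rw [matrixOf_refl, one_mul, mul_one]⟩
  | gen i j k hij hik hjk =>
    refine ⟨_, L.persp_inducedBy i j k hik hjk, fun Y hY => ?_⟩
    have hm : ∀ k j, D.minor k j * Y = Y * D.minor k j := by
      intro k j
      rw [minor, sub_mul, mul_sub, mul_assoc, D.U_mul_comm j, ← mul_assoc, hY, mul_assoc,
        ← D.U_mul_comm j, mul_assoc (D.U k), hY, ← mul_assoc, D.U_mul_comm k, mul_assoc]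
      simp only [D.U_mul_comm, mul_assoc]
    apply D.eq_of_minor_mul_eq (Ne.symm hjk)
    rw [← mul_assoc, minor_mul_matrixOf_proj, ← mul_assoc, hm, hm, mul_assoc,
      minor_mul_matrixOf_proj]
  | comp _ _ hf hg =>
    obtain ⟨e, he, hY⟩ := hf
    obtain ⟨e', he', hY'⟩ := hg
    refine ⟨_, he.trans he', fun Y h => ?_⟩
    rw [matrixOf_trans, mul_assoc, hY Y h, ← mul_assoc, hY' Y h, mul_assoc]

theorem G_comm_of_V_comm (h : ∀ j k, D.V j * D.V k = D.V k * D.V j) (i : Fin s)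
    (f g : L.G i) : f * g = g * f := by
  obtain ⟨f, hf⟩ := f
  obtain ⟨g, hg⟩ := g
  refine Subtype.ext ?_
  change g.trans f = f.trans g
  obtain ⟨e, he, hY⟩ := D.exists_linearEquiv_of_isArrow hf
  obtain ⟨e', he', hY'⟩ := D.exists_linearEquiv_of_isArrow hg
  -- Double centralizer: each `V m` is an admissible `Y` for `e'`, so the matrix of `e'` is an
  -- admissible `Y` for `e`.
  have hc : D.matrixOf e * D.matrixOf e' = D.matrixOf e' * D.matrixOf e :=
    hY _ fun m => (hY' _ fun n => h n m).symm
  have hee : e'.trans e = e.trans e' := by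
    apply D.matrixOf_injective
    rw [matrixOf_trans, matrixOf_trans, hc]
  ext p
  rw [(he'.trans he) p, (he.trans he') p]
  simp only [hee]

theorem exists_matrixOf_mul_eq_smul {i : Fin s} {f g : ℙ K (L.line i) ≃ ℙ K (L.line i)}
    {e e' : L.line i ≃ₗ[K] L.line i} (he : InducedBy f e) (he' : InducedBy g e')
    (h : f.trans g = g.trans f) :
    ∃ t : K, D.matrixOf e * D.matrixOf e' = t • (D.matrixOf e' * D.matrixOf e) := by
  obtain ⟨t, ht⟩ := (he'.trans he).exists_smul (h ▸ he.trans he')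
  exact ⟨t, by rw [← matrixOf_trans, ← matrixOf_trans, D.matrixOf_eq_smul ht]⟩

/-- The loop is `(x, 0) ↦ (0, -V_j x) ↦ (V_j x, 0)`, projecting along `L_j` and then along `L_c`. -/
theorem exists_isArrow_matrixOf_eq_V (hab : a ≠ b) (hac : a ≠ c) (hbc : b ≠ c) {j : Fin s}
    (hja : j ≠ a) (hjb : j ≠ b) : ∃ (f : _) (e : L.line a ≃ₗ[K] L.line a),
      L.IsArrow a a f ∧ InducedBy f e ∧ D.matrixOf e = D.V j := by
  refine ⟨_, _, (SkewLines.IsArrow.gen a b j hab hja.symm hjb.symm).comp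
    (SkewLines.IsArrow.gen b a c hab.symm hbc hac),
    (L.persp_inducedBy _ _ _ _ _).trans (L.persp_inducedBy _ _ _ _ _), ?_⟩
  have h1 := D.minor_mul_matrixOf_proj a b j hja.symm hjb.symm
  have h2 := D.minor_mul_matrixOf_proj b a c hbc hac
  simp only [minor, D.U_of_ne j hjb, D.U_of_ne a hab, D.U_of_ne c hbc.symm, D.U_b, D.V_a, D.V_b,
    D.V_c, mul_zero, mul_one, zero_sub, sub_zero, neg_mul, one_mul] at h1 h2
  rw [matrixOf_trans, h2, ← h1, neg_mul, one_mul]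

/-- The loop is `(x, 0) ↦ (x, x) ↦ (x - V_j⁻¹ x, 0)`, projecting along `L_b` and then along `L_j`.
-/
theorem exists_isArrow_V_mul_matrixOf (hab : a ≠ b) (hac : a ≠ c) (hbc : b ≠ c) {j : Fin s}
    (hja : j ≠ a) (hjb : j ≠ b) (hjc : j ≠ c) : ∃ (f : _) (e : L.line a ≃ₗ[K] L.line a),
      L.IsArrow a a f ∧ InducedBy f e ∧ D.V j * D.matrixOf e = D.V j - 1 := by
  refine ⟨_, _, (SkewLines.IsArrow.gen a c b hac hab hbc.symm).comp
    (SkewLines.IsArrow.gen c a j hac.symm hjc.symm hja.symm),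
    (L.persp_inducedBy _ _ _ _ _).trans (L.persp_inducedBy _ _ _ _ _), ?_⟩
  have h1 := D.minor_mul_matrixOf_proj a c b hab hbc.symm
  have h2 := D.minor_mul_matrixOf_proj c a j hjc.symm hja.symm
  simp only [minor, D.U_of_ne j hjb, D.U_of_ne a hab, D.U_of_ne c hbc.symm, D.U_b, D.V_a, D.V_b,
    D.V_c, mul_zero, mul_one, sub_zero, one_mul] at h1 h2
  rw [matrixOf_trans, h1, mul_one, h2]

theorem V_comm_of_G_comm (hs : 3 ≤ s) (hab : a ≠ b) (hac : a ≠ c) (hbc : b ≠ c) {i : Fin s}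
    (h : ∀ g h : L.G i, g * h = h * g) (j k : Fin s) : D.V j * D.V k = D.V k * D.V j := by
  by_cases hja : j = a
  · simp [hja, D.V_a]
  by_cases hjb : j = b
  · simp [hjb, D.V_b]
  by_cases hjc : j = c
  · simp [hjc, D.V_c]
  by_cases hka : k = a
  · simp [hka, D.V_a]
  by_cases hkb : k = b
  · simp [hkb, D.V_b]
  by_cases hkc : k = c
  · simp [hkc, D.V_c]
  obtain ⟨f, e, hf, hfe, he⟩ := D.exists_isArrow_matrixOf_eq_V hab hac hbc hja hjb
  obtain ⟨f₁, e₁, hf₁, hfe₁, he₁⟩ := D.exists_isArrow_matrixOf_eq_V hab hac hbc hka hkb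
  obtain ⟨f₂, e₂, hf₂, hfe₂, he₂⟩ := D.exists_isArrow_V_mul_matrixOf hab hac hbc hka hkb hkc
  obtain ⟨t, ht⟩ := D.exists_matrixOf_mul_eq_smul hfe hfe₁ (L.trans_comm_of_G_comm hs h hf hf₁)
  obtain ⟨t', ht'⟩ := D.exists_matrixOf_mul_eq_smul hfe hfe₂ (L.trans_comm_of_G_comm hs h hf hf₂)
  have hinv : D.matrixOf e.symm * D.V j = 1 := by
    rw [← he, ← matrixOf_trans, LinearEquiv.self_trans_symm, matrixOf_refl]
  rw [he, he₁] at ht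
  rw [he] at ht'
  exact Matrix.commute_of_projectively_commute hinv ht he₂ ht'

end LineCoordinates

/-! ### Transversals, quadrics and tangency in coordinates. -/

namespace LineCoordinates

open Matrix

variable {F : Type u} [Field F] {s : ℕ} {W : Fin s → Submodule F (Fin 4 → F)} {a b c : Fin s}
  (C : LineCoordinates W a b c)

include C

theorem smul_P_add_smul_R (p q : F) (x y : Fin 2 → F) :
    p • (C.P *ᵥ x) + q • (C.R *ᵥ y) = C.P *ᵥ (p • x) + C.R *ᵥ (q • y) := by
  rw [mulVec_smul, mulVec_smul]

theorem P_add_R_ne_zero {x y : Fin 2 → F} (h : x ≠ 0 ∨ y ≠ 0) : C.P *ᵥ x + C.R *ᵥ y ≠ 0 := by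
  intro h0
  have h1 := C.injective (x' := 0) (y' := 0) (by simpa using h0)
  simp [h1] at h

theorem finrank_span_pair {x y : Fin 2 → F} (hx : x ≠ 0) (hy : y ≠ 0) :
    Module.finrank F (Submodule.span F {C.P *ᵥ x, C.R *ᵥ y}) = 2 := by
  have hli : LinearIndependent F ![C.P *ᵥ x, C.R *ᵥ y] := by
    rw [LinearIndependent.pair_iff]
    intro p q h
    rw [C.smul_P_add_smul_R] at h
    have h1 := C.injective (x' := 0) (y' := 0) (by simpa using h)
    exact ⟨(smul_eq_zero.1 h1.1).resolve_right hx, (smul_eq_zero.1 h1.2).resolve_right hy⟩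
  rw [← Matrix.range_cons_cons_empty _ _ ![], finrank_span_eq_card hli, Fintype.card_fin]

theorem eq_span_pair {T : Submodule F (Fin 4 → F)} (hT : Module.finrank F T = 2)
    {x y : Fin 2 → F} (hx : x ≠ 0) (hy : y ≠ 0) (hxT : C.P *ᵥ x ∈ T) (hyT : C.R *ᵥ y ∈ T) :
    T = Submodule.span F {C.P *ᵥ x, C.R *ᵥ y} := by
  symm
  apply Submodule.eq_of_le_of_finrank_eq
  · rw [Submodule.span_le]
    rintro _ (rfl | rfl)
    exacts [hxT, hyT]
  · rw [hT, C.finrank_span_pair hx hy]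

/-- A line that meets all lines of the family comes from a common eigenvector. -/
theorem exists_eigenvector_of_transversal (hab : a ≠ b) (hcb : c ≠ b)
    {T : Submodule F (Fin 4 → F)} (hT : Module.finrank F T = 2) (hW : ∀ i, T ⊓ W i ≠ ⊥) :
    ∃ v, v ≠ 0 ∧ T = Submodule.span F {C.P *ᵥ v, C.R *ᵥ v} ∧
      ∀ j, ∃ p : F, C.V j *ᵥ v = p • v := by
  obtain ⟨_, ⟨hxT, hx⟩, hx0⟩ := (Submodule.ne_bot_iff _).1 (hW a)
  obtain ⟨x, rfl⟩ := (C.mem_a_iff hab _).1 hx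
  obtain ⟨_, ⟨hyT, hy⟩, hy0⟩ := (Submodule.ne_bot_iff _).1 (hW b)
  obtain ⟨y, rfl⟩ := (C.mem_b_iff _).1 hy
  obtain ⟨_, ⟨hzT, hz⟩, hz0⟩ := (Submodule.ne_bot_iff _).1 (hW c)
  obtain ⟨z, rfl⟩ := (C.mem_c_iff hcb _).1 hz
  have hx' : x ≠ 0 := by rintro rfl; simp at hx0
  have hy' : y ≠ 0 := by rintro rfl; simp at hy0
  have hz' : z ≠ 0 := by rintro rfl; simp at hz0
  have hTxy := C.eq_span_pair hT hx' hy' hxT hyT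
  have hzxy := hzT
  rw [hTxy] at hzxy
  obtain ⟨p, q, hpq⟩ := Submodule.mem_span_pair.1 hzxy
  rw [C.smul_P_add_smul_R] at hpq
  obtain ⟨hp, hq⟩ := C.injective hpq
  -- The point `(z, z)` of `T` on `L_c` is `p (x, 0) + q (0, y)`, so `z` is a multiple of both `x`
  -- and `y`.
  have hPz : C.P *ᵥ z ∈ T := by
    rw [← hp, mulVec_smul]; exact T.smul_mem _ hxT
  have hRz : C.R *ᵥ z ∈ T := by
    rw [← hq, mulVec_smul]; exact T.smul_mem _ hyT
  have hTz := C.eq_span_pair hT hz' hz' hPz hRz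
  refine ⟨z, hz', hTz, fun j => ?_⟩
  by_cases hjb : j = b
  · exact ⟨1, by simp [hjb, C.V_b]⟩
  obtain ⟨_, ⟨hwT, hw⟩, hw0⟩ := (Submodule.ne_bot_iff _).1 (hW j)
  obtain ⟨w, rfl⟩ := (C.mem_iff_of_ne hjb _).1 hw
  rw [hTz] at hwT
  obtain ⟨p, q, hpq⟩ := Submodule.mem_span_pair.1 hwT
  rw [C.smul_P_add_smul_R] at hpq
  obtain ⟨h1, h2⟩ := C.injective hpq
  have hp0 : p ≠ 0 := by
    rintro rfl
    rw [zero_smul] at h1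
    simp [← h1] at hw0
  refine ⟨p⁻¹ * q, ?_⟩
  rw [← h1, mulVec_smul] at h2
  rw [mul_smul, h2, smul_smul, inv_mul_cancel₀ hp0, one_smul]

theorem span_pair_inf_ne_bot {v : Fin 2 → F} (hv : v ≠ 0) {j : Fin s} {p : F}
    (h : C.V j *ᵥ v = p • v) : Submodule.span F {C.P *ᵥ v, C.R *ᵥ v} ⊓ W j ≠ ⊥ := by
  rw [Submodule.ne_bot_iff]
  by_cases hjb : j = b
  · refine ⟨C.R *ᵥ v, ⟨Submodule.subset_span (by simp), ?_⟩, ?_⟩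
    · rw [hjb]; exact (C.mem_b_iff _).2 ⟨v, rfl⟩
    · simpa using C.P_add_R_ne_zero (x := 0) (Or.inr hv)
  · refine ⟨C.P *ᵥ v + C.R *ᵥ (C.V j *ᵥ v), ⟨?_, (C.mem_iff_of_ne hjb _).2 ⟨v, rfl⟩⟩,
      C.P_add_R_ne_zero (Or.inl hv)⟩
    rw [h, mulVec_smul]
    exact Submodule.mem_span_pair.2 ⟨1, p, by simp⟩

theorem V_comm_of_two_transversals (hab : a ≠ b) (hcb : c ≠ b)
    {T T' : Submodule F (Fin 4 → F)} (hne : T ≠ T') (hT : Module.finrank F T = 2)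
    (hW : ∀ i, T ⊓ W i ≠ ⊥) (hT' : Module.finrank F T' = 2) (hW' : ∀ i, T' ⊓ W i ≠ ⊥)
    (j k : Fin s) : C.V j * C.V k = C.V k * C.V j := by
  obtain ⟨v, hv, hTv, h⟩ := C.exists_eigenvector_of_transversal hab hcb hT hW
  obtain ⟨w, hw, hTw, h'⟩ := C.exists_eigenvector_of_transversal hab hcb hT' hW'
  have hvw : wedge v w ≠ 0 := by
    intro h0
    obtain ⟨t, rfl⟩ := exists_eq_smul_of_wedge_eq_zero hv h0
    refine hne ?_
    rw [hTw]
    refine C.eq_span_pair hT hw hw ?_ ?_ <;> rw [hTv, mulVec_smul] <;>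
      exact Submodule.smul_mem _ _ (Submodule.subset_span (by simp))
  obtain ⟨p, hp⟩ := h j
  obtain ⟨p', hp'⟩ := h' j
  obtain ⟨q, hq⟩ := h k
  obtain ⟨q', hq'⟩ := h' k
  exact Matrix.commute_of_common_eigenvectors hvw hp hp' hq hq'

/-- Vanishing on `L_a` and `L_b` reduces `Q` to a bilinear pairing of `x` and `y`; vanishing on
`L_c` makes it alternating, hence a multiple of the determinant. -/
theorem quadric_apply (hab : a ≠ b) (hcb : c ≠ b) {Q : QuadraticForm F (Fin 4 → F)}
    (ha : QuadricContains Q (W a)) (hb : QuadricContains Q (W b)) (hc : QuadricContains Q (W c)) :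
    ∃ t : F, ∀ x y, Q (C.P *ᵥ x + C.R *ᵥ y) = t * wedge x y := by
  have hP : ∀ x, Q (C.P *ᵥ x) = 0 := fun x => ha _ ((C.mem_a_iff hab _).2 ⟨x, rfl⟩)
  have hR : ∀ x, Q (C.R *ᵥ x) = 0 := fun x => hb _ ((C.mem_b_iff _).2 ⟨x, rfl⟩)
  have hPR : ∀ x, Q (C.P *ᵥ x + C.R *ᵥ x) = 0 := fun x => hc _ ((C.mem_c_iff hcb _).2 ⟨x, rfl⟩)
  set B := Q.polarBilin.compl₁₂ C.P.mulVecLin C.R.mulVecLin with hB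
  have hBapp : ∀ x y, Q (C.P *ᵥ x + C.R *ᵥ y) = B x y := by
    intro x y
    simp only [hB, LinearMap.compl₁₂_apply, mulVecLin_apply, QuadraticMap.polarBilin_apply_apply,
      QuadraticMap.polar, hP, hR, sub_zero]
  have halt : B.IsAlt := fun x => by rw [← hBapp, hPR]
  refine ⟨B (Pi.single 0 1) (Pi.single 1 1), fun x y => ?_⟩
  have hd : ∀ x : Fin 2 → F, x = x 0 • Pi.single 0 1 + x 1 • Pi.single 1 1 := by
    intro x
    ext i
    fin_cases i <;> simp
  rw [hBapp]
  conv_lhs => rw [hd x, hd y]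
  simp only [map_add, map_smul, LinearMap.add_apply, LinearMap.smul_apply, halt.self_eq_zero,
    smul_eq_mul, ← halt.neg (Pi.single 1 1) (Pi.single 0 1), wedge]
  rw [← halt.neg (Pi.single 0 1) (Pi.single 1 1)]
  ring

theorem polar_apply {Q : QuadraticForm F (Fin 4 → F)} {t : F}
    (hQ : ∀ x y, Q (C.P *ᵥ x + C.R *ᵥ y) = t * wedge x y) (x y x' y' : Fin 2 → F) :
    QuadraticMap.polar Q (C.P *ᵥ x + C.R *ᵥ y) (C.P *ᵥ x' + C.R *ᵥ y') =
      t * (wedge x y' + wedge x' y) := by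
  have h : C.P *ᵥ x + C.R *ᵥ y + (C.P *ᵥ x' + C.R *ᵥ y') =
      C.P *ᵥ (x + x') + C.R *ᵥ (y + y') := by
    simp only [mulVec_add]; abel
  rw [QuadraticMap.polar, h, hQ, hQ, hQ]
  simp only [wedge, Pi.add_apply]
  ring

theorem ne_zero_of_isSmoothQuadric {Q : QuadraticForm F (Fin 4 → F)} {t : F}
    (hQ : ∀ x y, Q (C.P *ᵥ x + C.R *ᵥ y) = t * wedge x y) (h : IsSmoothQuadric Q) : t ≠ 0 := by
  rintro rfl
  have h0 : ∀ v, Q v = 0 := fun v => by rw [C.eq_add v, hQ, zero_mul]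
  obtain ⟨w, hw⟩ := h (C.P *ᵥ ![1, 0] + C.R *ᵥ 0)
    (C.P_add_R_ne_zero (Or.inl fun h => by simpa using congrFun h 0)) (h0 _)
  simp [QuadraticMap.polar, h0] at hw

/-- The polar form at `(v, p v)` in the direction `(w, V_j w)` is `t * wedge v (V_j w - p w)`. It
vanishes for a contained line as well as for a tangent one. -/
theorem V_comm_of_tangent (hab : a ≠ b) (hcb : c ≠ b) {T : Submodule F (Fin 4 → F)}
    (hT : Module.finrank F T = 2) (hW : ∀ i, T ⊓ W i ≠ ⊥) {Q : QuadraticForm F (Fin 4 → F)}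
    (hQ : IsSmoothQuadric Q) (ha : QuadricContains Q (W a)) (hb : QuadricContains Q (W b))
    (hc : QuadricContains Q (W c))
    (h : ∀ i, QuadricContains Q (W i) ∨ ∀ p ∈ W i ⊓ T, p ≠ 0 → IsTangentAt Q (W i) p)
    (j k : Fin s) : C.V j * C.V k = C.V k * C.V j := by
  obtain ⟨v, hv, hTv, hev⟩ := C.exists_eigenvector_of_transversal hab hcb hT hW
  obtain ⟨t, ht⟩ := C.quadric_apply hab hcb ha hb hc
  have ht0 := C.ne_zero_of_isSmoothQuadric ht hQ
  have key : ∀ j, ∃ p : F, C.V j *ᵥ v = p • v ∧ ∀ w, wedge v (C.V j *ᵥ w - p • w) = 0 := by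
    intro j
    obtain ⟨p, hp⟩ := hev j
    refine ⟨p, hp, fun w => ?_⟩
    by_cases hjb : j = b
    · rw [hjb, C.V_b, one_mulVec] at hp ⊢
      have hp1 : (1 - p) • v = 0 := by rw [sub_smul, one_smul, ← hp, sub_self]
      rw [← sub_eq_zero.1 ((smul_eq_zero.1 hp1).resolve_right hv), one_smul, sub_self]
      simp [wedge]
    have hmem : ∀ x, C.P *ᵥ x + C.R *ᵥ (C.V j *ᵥ x) ∈ W j :=
      fun x => (C.mem_iff_of_ne hjb _).2 ⟨x, rfl⟩
    have hpol : QuadraticMap.polar Q (C.P *ᵥ v + C.R *ᵥ (C.V j *ᵥ v))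
        (C.P *ᵥ w + C.R *ᵥ (C.V j *ᵥ w)) = 0 := by
      rcases h j with hj | hj
      · rw [QuadraticMap.polar, hj _ (hmem v), hj _ (hmem w),
          hj _ ((W j).add_mem (hmem v) (hmem w)), sub_zero, sub_zero]
      · refine (hj _ ⟨hmem v, ?_⟩ (C.P_add_R_ne_zero (Or.inl hv))).2.2 _ (hmem w)
        rw [hTv, hp, mulVec_smul]
        exact Submodule.mem_span_pair.2 ⟨1, p, by simp⟩
    rw [C.polar_apply ht, hp] at hpol
    have h1 := (mul_eq_zero.1 hpol).resolve_left ht0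
    simp only [wedge, Pi.smul_apply, Pi.sub_apply, smul_eq_mul] at h1 ⊢
    linear_combination h1
  obtain ⟨p, hp, hp'⟩ := key j
  obtain ⟨q, hq, hq'⟩ := key k
  exact Matrix.commute_of_common_tangent hv hp hq hp' hq'

/-- The quadric that contains the three lines to which the coordinates are adapted. -/
noncomputable def quadric : QuadraticForm F (Fin 4 → F) :=
  QuadraticMap.linMulLin (LinearMap.proj 0 ∘ₗ C.P'.mulVecLin) (LinearMap.proj 1 ∘ₗ C.R'.mulVecLin) -
  QuadraticMap.linMulLin (LinearMap.proj 1 ∘ₗ C.P'.mulVecLin) (LinearMap.proj 0 ∘ₗ C.R'.mulVecLin)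

theorem quadric_P_add_R (x y : Fin 2 → F) :
    C.quadric (C.P *ᵥ x + C.R *ᵥ y) = 1 * wedge x y := by
  have h1 : C.P' *ᵥ (C.P *ᵥ x + C.R *ᵥ y) = x := by
    rw [mulVec_add, mulVec_mulVec, mulVec_mulVec, C.PP, C.PR, one_mulVec, zero_mulVec, add_zero]
  have h2 : C.R' *ᵥ (C.P *ᵥ x + C.R *ᵥ y) = y := by
    rw [mulVec_add, mulVec_mulVec, mulVec_mulVec, C.RP, C.RR, one_mulVec, zero_mulVec, zero_add]
  simp only [quadric, _root_.sub_apply, QuadraticMap.linMulLin_apply, LinearMap.comp_apply,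
    LinearMap.proj_apply, mulVecLin_apply, h1, h2, wedge, one_mul]

theorem isSmoothQuadric_quadric : IsSmoothQuadric C.quadric := by
  intro v hv _
  by_contra! h
  have h' : ∀ x y, wedge (C.P' *ᵥ v) y + wedge x (C.R' *ᵥ v) = 0 := by
    intro x y
    have h1 := h (C.P *ᵥ x + C.R *ᵥ y)
    rw [C.eq_add v, C.polar_apply C.quadric_P_add_R, one_mul] at h1
    exact h1
  refine hv ?_
  have hx : C.P' *ᵥ v = 0 := by
    have h0 := h' 0 ![0, 1]
    have h1 := h' 0 ![1, 0]
    ext i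
    fin_cases i
    · simpa [wedge] using h0
    · simpa [wedge] using h1
  have hy : C.R' *ᵥ v = 0 := by
    have h0 := h' ![0, 1] 0
    have h1 := h' ![1, 0] 0
    ext i
    fin_cases i
    · simpa [wedge] using h0
    · simpa [wedge] using h1
  rw [C.eq_add v, hx, hy, mulVec_zero, mulVec_zero, add_zero]

theorem quadricContains_quadric_a (hab : a ≠ b) : QuadricContains C.quadric (W a) := by
  intro v hv
  obtain ⟨x, rfl⟩ := (C.mem_a_iff hab _).1 hv
  have h := C.quadric_P_add_R x 0
  simpa [wedge] using h

theorem quadricContains_quadric_b : QuadricContains C.quadric (W b) := by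
  intro v hv
  obtain ⟨x, rfl⟩ := (C.mem_b_iff _).1 hv
  have h := C.quadric_P_add_R 0 x
  simpa [wedge] using h

theorem quadricContains_quadric_c (hcb : c ≠ b) : QuadricContains C.quadric (W c) := by
  intro v hv
  obtain ⟨x, rfl⟩ := (C.mem_c_iff hcb _).1 hv
  rw [C.quadric_P_add_R, wedge_self, mul_zero]

/-- The point `(w, V_k w)` lies on no quadric `t * wedge x y = 0` with `t ≠ 0`. -/
theorem not_exists_isSmoothQuadric (hab : a ≠ b) (hcb : c ≠ b) {k : Fin s} {w : Fin 2 → F}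
    (hw : wedge w (C.V k *ᵥ w) ≠ 0) : ¬ ∃ Q : QuadraticForm F (Fin 4 → F),
      IsSmoothQuadric Q ∧ ∀ i, QuadricContains Q (W i) := by
  rintro ⟨Q, hQ, hi⟩
  obtain ⟨t, ht⟩ := C.quadric_apply hab hcb (hi a) (hi b) (hi c)
  have hkb : k ≠ b := by
    rintro rfl
    rw [C.V_b, one_mulVec, wedge_self] at hw
    exact hw rfl
  have h := hi k _ ((C.mem_iff_of_ne hkb _).2 ⟨w, rfl⟩)
  rw [ht] at h
  exact mul_ne_zero (C.ne_zero_of_isSmoothQuadric ht hQ) hw h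

theorem quadricContains_or_isTangentAt {v : Fin 2 → F} {j : Fin s} {p : F}
    (hp : C.V j *ᵥ v = p • v) (hw : ∀ w, wedge v (C.V j *ᵥ w - p • w) = 0) :
    QuadricContains C.quadric (W j) ∨ ∀ q ∈ W j ⊓ Submodule.span F {C.P *ᵥ v, C.R *ᵥ v},
      q ≠ 0 → IsTangentAt C.quadric (W j) q := by
  by_cases hjb : j = b
  · left
    rw [hjb]
    exact C.quadricContains_quadric_b
  -- A contained line also satisfies the polar condition, so all graphs are treated as tangent. The
  -- point `q` is `r (v, p v)`.
  right
  rintro q ⟨hq, hqT⟩ -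
  refine ⟨hq, ?_⟩
  obtain ⟨x, rfl⟩ := (C.mem_iff_of_ne hjb _).1 hq
  obtain ⟨r, r', hr⟩ := Submodule.mem_span_pair.1 hqT
  rw [C.smul_P_add_smul_R] at hr
  obtain ⟨rfl, -⟩ := C.injective hr
  rw [mulVec_smul (C.V j), hp]
  refine ⟨?_, fun w hwj => ?_⟩
  · rw [C.quadric_P_add_R]
    simp only [wedge, Pi.smul_apply, smul_eq_mul]
    ring
  · obtain ⟨y, rfl⟩ := (C.mem_iff_of_ne hjb _).1 hwj
    rw [C.polar_apply C.quadric_P_add_R]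
    have h1 := hw y
    simp only [wedge, Pi.smul_apply, Pi.sub_apply, smul_eq_mul] at h1 ⊢
    linear_combination r * h1

end LineCoordinates

/-! ### Existence of adapted coordinates. -/

open Matrix in
theorem SkewLines.exists_lineCoordinates {K : Type u} [Field K] {s : ℕ} (L : SkewLines K s)
    {a b c : Fin s} (hab : a ≠ b) (hac : a ≠ c) (hbc : b ≠ c) :
    Nonempty (LineCoordinates L.line a b c) := by
  classical
  have ea : (Fin 2 → K) ≃ₗ[K] L.line a :=
    LinearEquiv.ofFinrankEq _ _ (by simp [L.finrank_line])
  -- The sign puts `ea x + eb x` on `L_c`, because `x` minus its projection to `L_b` along `L_c`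
  -- lies in `L_c`.
  let eb : (Fin 2 → K) ≃ₗ[K] L.line b :=
    ea.trans ((L.proj a b c hac hbc).trans (LinearEquiv.neg K))
  let Φ : ((Fin 2 → K) × (Fin 2 → K)) ≃ₗ[K] (Fin 4 → K) :=
    (ea.prodCongr eb).trans (Submodule.prodEquivOfIsCompl _ _ (L.isCompl hab))
  have hΦ : ∀ x y, Φ (x, y) = (ea x : Fin 4 → K) + eb y := by
    intro x y
    simp [Φ]
  let P := LinearMap.toMatrix' (Φ.toLinearMap ∘ₗ LinearMap.inl K _ _)
  let R := LinearMap.toMatrix' (Φ.toLinearMap ∘ₗ LinearMap.inr K _ _)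
  let P' := LinearMap.toMatrix' (LinearMap.fst K _ _ ∘ₗ Φ.symm.toLinearMap)
  let R' := LinearMap.toMatrix' (LinearMap.snd K _ _ ∘ₗ Φ.symm.toLinearMap)
  have hP : ∀ x, P *ᵥ x = Φ (x, 0) := fun x => by simp [P, LinearMap.toMatrix'_mulVec]
  have hR : ∀ x, R *ᵥ x = Φ (0, x) := fun x => by simp [R, LinearMap.toMatrix'_mulVec]
  have hPR : ∀ x y, P *ᵥ x + R *ᵥ y = Φ (x, y) := fun x y => by
    rw [hP, hR, ← map_add, Prod.mk_add_mk, add_zero, zero_add]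
  have hP' : ∀ v, P' *ᵥ v = (Φ.symm v).1 := fun x => by simp [P', LinearMap.toMatrix'_mulVec]
  have hR' : ∀ v, R' *ᵥ v = (Φ.symm v).2 := fun x => by simp [R', LinearMap.toMatrix'_mulVec]
  -- `S j hj x` is the point of `L_j` whose component in `L_a` is `ea x`; its component in `L_b`
  -- defines `V j`.
  let S : ∀ j, j ≠ b → (Fin 2 → K) →ₗ[K] (Fin 4 → K) := fun j hj =>
    (L.line j).subtype ∘ₗ (L.proj a j b hab hj).toLinearMap ∘ₗ ea.toLinearMap
  let V : Fin s → Matrix (Fin 2) (Fin 2) K := fun j =>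
    if hj : j = b then 1 else
      LinearMap.toMatrix' (LinearMap.snd K _ _ ∘ₗ Φ.symm.toLinearMap ∘ₗ S j hj)
  have hV : ∀ j (hj : j ≠ b) x, Φ (x, V j *ᵥ x) = S j hj x := by
    intro j hj x
    have h1 := L.proj_sub_mem a j b hab hj (ea x)
    obtain ⟨y, hy⟩ := eb.surjective ⟨_, h1⟩
    have h2 : S j hj x = Φ (x, y) := by
      rw [hΦ, hy]
      simp [S]
    have h3 : V j *ᵥ x = y := by
      simp only [V, dif_neg hj, LinearMap.toMatrix'_mulVec, LinearMap.comp_apply, h2,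
        LinearEquiv.coe_coe, LinearEquiv.symm_apply_apply, LinearMap.snd_apply]
    rw [h3, h2]
  have hS : ∀ j hj x, S j hj x ∈ L.line j := fun j hj x => Subtype.coe_prop _
  have huniq : ∀ j (_ : j ≠ b) x y z, Φ (x, y) ∈ L.line j → Φ (x, z) ∈ L.line j → y = z := by
    intro j hj x y z hy hz
    have h1 := (L.line j).sub_mem hy hz
    rw [hΦ, hΦ, add_sub_add_left_eq_sub, ← Submodule.coe_sub, ← map_sub] at h1
    have h2 := Submodule.disjoint_def.1 (L.skew j b hj) _ h1 (Subtype.coe_prop _)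
    exact sub_eq_zero.1 (eb.map_eq_zero_iff.1 (Subtype.ext h2))
  refine ⟨{
    P := P, R := R, P' := P', R' := R', U := fun j => if j = b then 0 else 1, V := V
    PP := ?_, PR := ?_, RP := ?_, RR := ?_, add_eq := ?_
    U_b := if_pos rfl, U_of_ne := fun j hj => if_neg hj
    V_a := ?_, V_b := dif_pos rfl, V_c := ?_, eq_range := fun j => ?_ }⟩
  · refine Matrix.ext_of_mulVec_single fun m => ?_
    rw [← mulVec_mulVec, hP, hP', LinearEquiv.symm_apply_apply, one_mulVec]
  · refine Matrix.ext_of_mulVec_single fun m => ?_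
    rw [← mulVec_mulVec, hR, hP', LinearEquiv.symm_apply_apply, zero_mulVec]
  · refine Matrix.ext_of_mulVec_single fun m => ?_
    rw [← mulVec_mulVec, hP, hR', LinearEquiv.symm_apply_apply, zero_mulVec]
  · refine Matrix.ext_of_mulVec_single fun m => ?_
    rw [← mulVec_mulVec, hR, hR', LinearEquiv.symm_apply_apply, one_mulVec]
  · refine Matrix.ext_of_mulVec_single fun m => ?_
    rw [add_mulVec, ← mulVec_mulVec, ← mulVec_mulVec, hPR, hP', hR', one_mulVec, Prod.mk.eta,
      LinearEquiv.apply_symm_apply]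
  · refine Matrix.ext_of_mulVec_single fun m => ?_
    rw [zero_mulVec]
    refine huniq a hab _ _ _ (hV a hab _ ▸ hS a hab _) ?_
    rw [hΦ, map_zero, Submodule.coe_zero, add_zero]
    exact Subtype.coe_prop _
  · refine Matrix.ext_of_mulVec_single fun m => ?_
    rw [one_mulVec]
    refine huniq c hbc.symm _ _ _ (hV c hbc.symm _ ▸ hS c hbc.symm _) ?_
    have h1 := (L.line c).neg_mem (L.proj_sub_mem a b c hac hbc (ea (Pi.single m 1)))
    rw [hΦ]
    simpa [eb, sub_eq_add_neg, add_comm] using h1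
  · ext v
    by_cases hj : j = b
    · subst hj
      have hVj : V j = 1 := dif_pos rfl
      simp only [if_true, Matrix.mul_zero, zero_add, hVj, Matrix.mul_one, LinearMap.mem_range,
        mulVecLin_apply, hR, hΦ, map_zero, Submodule.coe_zero]
      constructor
      · intro hv
        exact ⟨eb.symm ⟨v, hv⟩, by rw [LinearEquiv.apply_symm_apply]⟩
      · rintro ⟨y, rfl⟩
        exact Subtype.coe_prop _
    · simp only [if_neg hj, Matrix.mul_one, LinearMap.mem_range, mulVecLin_apply, add_mulVec,
        ← mulVec_mulVec, hPR, hV j hj]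
      constructor
      · intro hv
        exact ⟨ea.symm ((L.proj a j b hab hj).symm ⟨v, hv⟩), by simp [S]⟩
      · rintro ⟨y, rfl⟩
        exact hS j hj y

/-! ### Passage to the algebraic closure. -/

section AlgebraicClosure

open Matrix

variable {K : Type u} [Field K] {s : ℕ} {L : SkewLines K s} {a b c : Fin s}

theorem SkewLines.geomLine_eq_range {n : ℕ} {A : Matrix (Fin 4) (Fin n) K} {j : Fin s}
    (h : L.line j = LinearMap.range A.mulVecLin) :
    L.geomLine j = LinearMap.range (A.map (algebraMap K (AlgebraicClosure K))).mulVecLin := by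
  have hmap : ∀ x, (A.map (algebraMap K (AlgebraicClosure K))) *ᵥ
      (fun t => algebraMap K (AlgebraicClosure K) (x t)) =
      fun t => algebraMap K (AlgebraicClosure K) ((A *ᵥ x) t) := by
    intro x
    ext t
    rw [RingHom.map_mulVec]
    rfl
  rw [geomLine, h]
  apply le_antisymm
  · rw [Submodule.span_le]
    rintro _ ⟨_, ⟨x, rfl⟩, rfl⟩
    exact ⟨_, hmap x⟩
  · rw [Matrix.range_mulVecLin, Submodule.span_le]
    rintro _ ⟨m, rfl⟩
    refine Submodule.subset_span ⟨A.col m, ⟨Pi.single m 1, by simp⟩, ?_⟩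
    ext t
    simp

/-- Extension of coordinates on a family of lines to the algebraic closure. -/
noncomputable def LineCoordinates.baseChange (C : LineCoordinates L.line a b c) :
    LineCoordinates L.geomLine a b c where
  P := C.P.map (algebraMap K _)
  R := C.R.map (algebraMap K _)
  P' := C.P'.map (algebraMap K _)
  R' := C.R'.map (algebraMap K _)
  U j := (C.U j).map (algebraMap K _)
  V j := (C.V j).map (algebraMap K _)
  PP := by rw [← Matrix.map_mul, C.PP]; simp
  PR := by rw [← Matrix.map_mul, C.PR]; simp
  RP := by rw [← Matrix.map_mul, C.RP]; simp
  RR := by rw [← Matrix.map_mul, C.RR]; simp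
  add_eq := by
    rw [← Matrix.map_mul, ← Matrix.map_mul, ← Matrix.map_add _ (map_add _), C.add_eq]; simp
  U_b := by rw [C.U_b]; simp
  U_of_ne j hj := by rw [C.U_of_ne j hj]; simp
  V_a := by rw [C.V_a]; simp
  V_b := by rw [C.V_b]; simp
  V_c := by rw [C.V_c]; simp
  eq_range j := by
    rw [SkewLines.geomLine_eq_range (C.eq_range j), Matrix.map_add _ (map_add _), Matrix.map_mul,
      Matrix.map_mul]

/-- This links the group, defined over `K`, to eigenvectors that may exist only over the closure. -/
theorem LineCoordinates.baseChange_V_comm_iff (C : LineCoordinates L.line a b c) (j k : Fin s) :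
    C.baseChange.V j * C.baseChange.V k = C.baseChange.V k * C.baseChange.V j ↔
      C.V j * C.V k = C.V k * C.V j := by
  change (C.V j).map (algebraMap K (AlgebraicClosure K)) * (C.V k).map (algebraMap K _) =
    (C.V k).map (algebraMap K _) * (C.V j).map (algebraMap K _) ↔ _
  rw [← Matrix.map_mul, ← Matrix.map_mul]
  exact (Matrix.map_injective (algebraMap K (AlgebraicClosure K)).injective).eq_iff

end AlgebraicClosure

/-! ### The equivalence. -/

theorem theorem2 {K : Type u} [Field K] (s : ℕ) (hs : 3 ≤ s) (L : SkewLines K s) (i : Fin s) :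
    (∀ g h : L.G i, g * h = h * g) ↔
      ((∃ T₁ T₂ : Submodule (AlgebraicClosure K) (Fin 4 → AlgebraicClosure K),
          T₁ ≠ T₂ ∧ L.IsTransversal T₁ ∧ L.IsTransversal T₂) ∨
        ∃ T : Submodule (AlgebraicClosure K) (Fin 4 → AlgebraicClosure K),
          L.IsMultTwoTransversal T) := by
  obtain ⟨a, b, c, hab, hac, hbc⟩ : ∃ a b c : Fin s, a ≠ b ∧ a ≠ c ∧ b ≠ c :=
    ⟨⟨0, by omega⟩, ⟨1, by omega⟩, ⟨2, by omega⟩, by simp, by simp, by simp⟩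
  constructor
  · intro h
    obtain ⟨C⟩ := L.exists_lineCoordinates hab hac hbc
    have hV := fun j k => (C.baseChange_V_comm_iff j k).2 (C.V_comm_of_G_comm hs hab hac hbc h j k)
    rcases Matrix.exists_common_eigenvectors _ hV with
      ⟨v, w, hvw, hj⟩ | ⟨v, hv, hj, k, w, hw⟩
    · left
      have hv : v ≠ 0 := by rintro rfl; simp [wedge] at hvw
      have hw : w ≠ 0 := by rintro rfl; simp [wedge] at hvw
      refine ⟨_, _, fun heq => hvw ?_,
        ⟨C.baseChange.finrank_span_pair hv hv,
          fun j => C.baseChange.span_pair_inf_ne_bot hv (hj j).1.choose_spec⟩,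
        ⟨C.baseChange.finrank_span_pair hw hw,
          fun j => C.baseChange.span_pair_inf_ne_bot hw (hj j).2.choose_spec⟩⟩
      -- If the two transversals coincided, `(w, 0)` would lie in the span of `(v, 0)` and `(0, v)`,
      -- making `w` a multiple of `v`.
      have h1 := heq ▸ Submodule.subset_span (R := AlgebraicClosure K)
        (s := {C.baseChange.P.mulVec w, C.baseChange.R.mulVec w}) (Set.mem_insert _ _)
      obtain ⟨p, q, hpq⟩ := Submodule.mem_span_pair.1 h1
      rw [C.baseChange.smul_P_add_smul_R] at hpq
      have hw' := C.baseChange.injective (y' := 0) (x' := w)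
        (hpq.trans (by rw [Matrix.mulVec_zero, add_zero]))
      rw [← hw'.1, wedge_smul_self]
    · right
      exact ⟨_, a, b, c, hab, hac, hbc,
        ⟨C.baseChange.finrank_span_pair hv hv,
          fun j => C.baseChange.span_pair_inf_ne_bot hv (hj j).choose_spec.1⟩,
        C.baseChange.not_exists_isSmoothQuadric hab hbc.symm hw,
        C.baseChange.quadric, C.baseChange.isSmoothQuadric_quadric,
        C.baseChange.quadricContains_quadric_a hab, C.baseChange.quadricContains_quadric_b,
        C.baseChange.quadricContains_quadric_c hbc.symm,
        fun j => C.baseChange.quadricContains_or_isTangentAt (hj j).choose_spec.1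
          (hj j).choose_spec.2⟩
  · rintro (⟨T, T', hne, ⟨hT, hW⟩, hT', hW'⟩ |
      ⟨T, a, b, c, hab, hac, hbc, ⟨hT, hW⟩, -, Q, hQ, ha, hb, hc, h⟩)
    · obtain ⟨C⟩ := L.exists_lineCoordinates hab hac hbc
      exact C.G_comm_of_V_comm (fun j k => (C.baseChange_V_comm_iff j k).1
        (C.baseChange.V_comm_of_two_transversals hab hbc.symm hne hT hW hT' hW' j k)) i
    -- These coordinates are adapted to the three indices that come with the multiplicity-two
    -- transversal.
    · obtain ⟨C⟩ := L.exists_lineCoordinates hab hac hbc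
      exact C.G_comm_of_V_comm (fun j k => (C.baseChange_V_comm_iff j k).1
        (C.baseChange.V_comm_of_tangent hab hbc.symm hT hW hQ ha hb hc h j k)) i
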